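/- Let $k \ge 4$ be an integer, let $n$ be even, and let $\pi = (d_1, \ldots, d_n)$ be a sequence of integers such that both $\pi$ and $\pi - k = (d_1 - k, \ldots, d_n - k)$ are graphic, i.e. each is the degree sequence of some simple graph on $n$ vertices. Then there is a simple graph $G$ with degree sequence $\pi$ (a realization of $\pi$) that contains five pairwise edge-disjoint spanning subgraphs, one of which is a $(k-4)$-factor (a spanning subgraph that is regular of degree $k-4$) and the other four of which are $1$-factors (perfect matchings). -/

import Mathlib

namespace DegreeSequence

open Classical in
/-- The simple graph `G` on the `n` vertices `0, …, n - 1` realizes the integer sequence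
`π = (π 0, …, π (n - 1))`: the vertex `i` has degree `π i`. The entries are integers, so that
`π - k` may be formed without truncation (a sequence with a negative entry has no realization). -/
def Realizes {n : ℕ} (G : SimpleGraph (Fin n)) (π : Fin n → ℤ) : Prop :=
  ∀ i : Fin n, (G.degree i : ℤ) = π i

/-- A sequence is graphic if some simple graph realizes it. -/
def Graphic {n : ℕ} (π : Fin n → ℤ) : Prop :=
  ∃ G : SimpleGraph (Fin n), Realizes G π

open Classical in
/-- `F` is an `r`-factor of `G`: a spanning subgraph of `G` in which every vertex has
degree `r`. For `r = 1` this is a perfect matching of `G`. -/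
def IsFactor {n : ℕ} (F G : SimpleGraph (Fin n)) (r : ℕ) : Prop :=
  F ≤ G ∧ F.IsRegularOfDegree r

end DegreeSequence

/-!
A realization of `π` with a `k`-factor is an edge coloring of the complete graph: one color for the
edges outside the factor, one for the non-edges, one for the factor, and matchings split off the
factor get colors of their own. It exists by Kundu's theorem (`EdgeColoring.exists_packing`), and
it remains to move perfect matchings from the factor color `f` to new colors one at a time, allowing
recolorings that keep all color degrees (`EdgeColoring.exists_extraction`).

By Hall's theorem the edges of color `f` contain a cover of the vertices by disjoint edges and
cycles. Among all colorings with the given degrees and all such covers, choose one with the fewest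
vertices on cycles (`EdgeColoring.IsMinimalCover`). Even cycles split into edges, so all cycles are
odd, and as the number of vertices is even there are at least two if there is any. If `u` and `v`
lie on different odd cycles, both cycles have matchings missing just `u` and `v`, so by minimality
no recoloring that keeps these matchings can give `uv` the color `f`. Two kinds of recoloring are
tried, where `y` is a neighbor of `u`, and `x` one of `v`, on the respective cycle.

* Fix two vertices `p` and `q`, and draw an arc from the color of `pw` to that of `qw` for each other
  vertex `w`. Exchanging the colors along a directed cycle keeps all degrees. For `v` and `y`, the
  arc at `u` leads from the color of `uv` to `f`. When it lies on no directed cycle, counting the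
  arcs at the set of colors that do not reach it shows that some color is more frequent at `y` than
  at `v`, and this must be one of the two non-regular colors
  (`EdgeColoring.exists_recoloring_of_degree_le`). Thus `uv` has neither of the two non-regular
  colors as soon as the degrees in one of them compare `v` with `y` the same way as `x` with `u`.
* If `uv` and `xy` have the same color, it can be exchanged with `f` on the 4-cycle `uvxy`.

Write `+` or `-` at each pair of a vertex of the first and a vertex of the second odd cycle,
according to which degree is larger. These pairs form a torus of odd dimensions, and for parity
reasons some square of the torus has both diagonals monochromatic
(`EdgeColoring.exists_square_diagonals_eq`). By the above, its four corners are edges in matching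
colors. Opposite corners have different colors by the second recoloring, and adjacent corners
because they share a vertex. So there are at least four matching colors, whereas at most three
matchings have been split off before the fourth.
-/

namespace EdgeColoring

open Finset

set_option linter.unusedSectionVars false

/-! ### Exchanging the colors at two vertices -/

section Switching

variable {V C : Type*} [Fintype V] [DecidableEq V] [DecidableEq C]

/-- The number of edges of color `z` at the vertex `v`, in the edge coloring `c` of the complete
graph on `V`. A coloring is a symmetric function on ordered pairs; its values on the diagonal are
ignored. -/
def colorDegree (c : V → V → C) (v : V) (z : C) : ℕ := #{w | w ≠ v ∧ c v w = z}

/-- The coloring in which the colors of `pw` and `qw` have been exchanged for every `w ∈ W`. -/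
def pairSwitch (c : V → V → C) (p q : V) (W : Finset V) : V → V → C := fun x y =>
  c (if y ∈ W then Equiv.swap p q x else x) (if x ∈ W then Equiv.swap p q y else y)

variable {c : V → V → C} {p q u : V} {W : Finset V}

lemma colorDegree_eq_add {v : V} (hv : v ∉ W) (z : C) :
    colorDegree c v z = #{w ∈ W | c v w = z} + #{w | w ∉ W ∧ w ≠ v ∧ c v w = z} := by
  rw [colorDegree, ← card_filter_add_card_filter_not (fun w => w ∈ W)]
  congr 2
  · ext w
    simp only [mem_filter, mem_univ, true_and]
    constructor
    · rintro ⟨⟨_, h⟩, h'⟩; exact ⟨h', h⟩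
    · rintro ⟨h', h⟩; exact ⟨⟨fun e => hv (e ▸ h'), h⟩, h'⟩
  · ext w
    simp only [mem_filter, mem_univ, true_and]
    tauto

lemma colorDegree_pairSwitch (hpq : p ≠ q) (hp : p ∉ W) (hq : q ∉ W)
    (hW : ∀ z, #{w ∈ W | c p w = z} = #{w ∈ W | c q w = z}) (v : V) (z : C) :
    colorDegree (pairSwitch c p q W) v z = colorDegree c v z := by
  by_cases hv : v ∈ W
  · have hvp : v ≠ p := fun e => hp (e ▸ hv)
    have hvq : v ≠ q := fun e => hq (e ▸ hv)
    refine card_equiv (Equiv.swap p q) fun w => ?_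
    have h1 : Equiv.swap p q v = v := Equiv.swap_apply_of_ne_of_ne hvp hvq
    have h2 : Equiv.swap p q w ≠ v ↔ w ≠ v := by
      rw [← h1, (Equiv.swap p q).injective.ne_iff, h1]
    simp [pairSwitch, hv, h1, h2]
  · rw [colorDegree_eq_add hv, colorDegree_eq_add hv]
    congr 1
    · by_cases hvp : v = p
      · subst hvp
        rw [hW z]
        congr 1
        refine filter_congr fun w hw => ?_
        simp [pairSwitch, hw, hv]
      by_cases hvq : v = q
      · subst hvq
        rw [← hW z]
        congr 1
        refine filter_congr fun w hw => ?_
        simp [pairSwitch, hw, hv]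
      · congr 1
        refine filter_congr fun w hw => ?_
        simp [pairSwitch, hw, hv, Equiv.swap_apply_of_ne_of_ne hvp hvq]
    · congr 1
      refine filter_congr fun w _ => ?_
      by_cases hw : w ∈ W <;> simp [pairSwitch, hw, hv]

lemma ne_of_colorDegree_eq_zero {v w : V} {z : C} (h : colorDegree c v z = 0) (hw : w ≠ v) :
    c v w ≠ z := fun e => by
  have : w ∈ ({w | w ≠ v ∧ c v w = z} : Finset V) := by simp [hw, e]
  rw [card_eq_zero.1 h] at this
  simp at this

/-- Exchanging the colors along a balanced set of vertices containing `u` puts the color of `qu`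
on `pu`, and it keeps all edges of a color `m` that is absent at `p`. -/
lemma exists_recoloring_of_balanced (hc : ∀ x y, c x y = c y x) {m : C} (hpq : p ≠ q)
    (hp : p ∉ W) (hq : q ∉ W) (hu : u ∈ W)
    (hW : ∀ z, #{w ∈ W | c p w = z} = #{w ∈ W | c q w = z}) (hm : colorDegree c p m = 0) :
    ∃ c' : V → V → C, (∀ x y, c' x y = c' y x) ∧
      (∀ v z, colorDegree c' v z = colorDegree c v z) ∧ c' p u = c q u ∧
      ∀ x y, x ≠ y → c x y = m → c' x y = m := by
  have hpm : ∀ w ∈ W, c p w ≠ m := fun w hw =>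
    ne_of_colorDegree_eq_zero hm fun e => hp (e ▸ hw)
  have hqm : ∀ w ∈ W, c q w ≠ m := by
    have := hW m
    rw [card_eq_zero.2 (filter_eq_empty_iff.2 fun w hw => hpm w hw), eq_comm, card_eq_zero,
      filter_eq_empty_iff] at this
    exact fun w hw => this hw
  have key : ∀ x y, c x y = m → y ∈ W → pairSwitch c p q W x y = m := by
    intro x y h hy
    have hyp : y ≠ p := fun e => hp (e ▸ hy)
    have hyq : y ≠ q := fun e => hq (e ▸ hy)
    by_cases hxp : x = p
    · exact absurd (hxp ▸ h) (hpm y hy)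
    by_cases hxq : x = q
    · exact absurd (hxq ▸ h) (hqm y hy)
    simp [pairSwitch, hy, Equiv.swap_apply_of_ne_of_ne hxp hxq,
      Equiv.swap_apply_of_ne_of_ne hyp hyq, h]
  have hsymm : ∀ x y, pairSwitch c p q W x y = pairSwitch c p q W y x := fun x y => hc _ _
  refine ⟨pairSwitch c p q W, hsymm, colorDegree_pairSwitch hpq hp hq hW, ?_, ?_⟩
  · simp [pairSwitch, hu, hp]
  · intro x y _ h
    by_cases hy : y ∈ W
    · exact key x y h hy
    by_cases hx : x ∈ W
    · rw [hsymm]; exact key y x (hc y x ▸ h) hx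
    simp [pairSwitch, hx, hy, h]

/-- In the digraph on the colors with an arc from `c p w` to `c q w` for each vertex `w` other than
`p` and `q`, the set `T` consists of the colors from which `z₀` can be reached, and `W` is the set
of vertices used by a path from `a` to `z₀`. -/
lemma exists_backward_closed [Fintype C] (c : V → V → C) (p q : V) (z₀ : C) :
    ∃ T : Finset C, z₀ ∈ T ∧
      (∀ a ∈ T, ∃ W : Finset V, (∀ w ∈ W, w ≠ p ∧ w ≠ q ∧ c p w ∈ T ∧ c p w ≠ z₀) ∧
        ∀ z, #{w ∈ W | c p w = z} + (if z = z₀ then 1 else 0) =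
          #{w ∈ W | c q w = z} + (if z = a then 1 else 0)) ∧
      ∀ w, w ≠ p → w ≠ q → c q w ∈ T → c p w ∈ T := by
  set Good : Set (Finset C) := {T | z₀ ∈ T ∧
      (∀ a ∈ T, ∃ W : Finset V, (∀ w ∈ W, w ≠ p ∧ w ≠ q ∧ c p w ∈ T ∧ c p w ≠ z₀) ∧
        ∀ z, #{w ∈ W | c p w = z} + (if z = z₀ then 1 else 0) =
          #{w ∈ W | c q w = z} + (if z = a then 1 else 0))} with hGood
  have h0 : {z₀} ∈ Good := by
    refine ⟨mem_singleton_self _, fun a ha => ⟨∅, by simp, fun z => ?_⟩⟩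
    rw [mem_singleton.1 ha]
    simp
  obtain ⟨T, -, hT⟩ := (Set.toFinite Good).exists_le_maximal h0
  refine ⟨T, hT.prop.1, hT.prop.2, fun w hwp hwq hw => ?_⟩
  by_contra hwT
  obtain ⟨W, hW1, hW2⟩ := hT.prop.2 _ hw
  have hwW : w ∉ W := fun h => hwT (hW1 w h).2.2.1
  have hwz : c p w ≠ z₀ := fun e => hwT (e ▸ hT.prop.1)
  have hmem : insert (c p w) T ∈ Good := by
    refine ⟨mem_insert_of_mem hT.prop.1, fun a ha => ?_⟩
    rcases mem_insert.1 ha with rfl | ha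
    · refine ⟨insert w W, ?_, fun z => ?_⟩
      · intro x hx
        rcases mem_insert.1 hx with rfl | hx
        · exact ⟨hwp, hwq, mem_insert_self _ _, hwz⟩
        · obtain ⟨h1, h2, h3, h4⟩ := hW1 x hx
          exact ⟨h1, h2, mem_insert_of_mem h3, h4⟩
      · have := hW2 z
        rw [filter_insert, filter_insert]
        have n1 : w ∉ ({x ∈ W | c p x = z} : Finset V) := fun h => hwW (mem_filter.1 h).1
        have n2 : w ∉ ({x ∈ W | c q x = z} : Finset V) := fun h => hwW (mem_filter.1 h).1
        rw [apply_ite card, apply_ite card, card_insert_of_notMem n1, card_insert_of_notMem n2]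
        simp only [eq_comm (a := z)] at this ⊢
        split_ifs at this ⊢ <;> omega
    · obtain ⟨W, h1, h2⟩ := hT.prop.2 a ha
      refine ⟨W, fun x hx => ?_, h2⟩
      obtain ⟨h1, h2, h3, h4⟩ := h1 x hx
      exact ⟨h1, h2, mem_insert_of_mem h3, h4⟩
  exact hwT (hT.le_of_ge hmem (subset_insert _ _) (mem_insert_self _ _))

lemma sum_colorDegree (c : V → V → C) (v : V) (X : Finset C) :
    ∑ z ∈ X, colorDegree c v z = #{w | w ≠ v ∧ c v w ∈ X} := by
  rw [card_eq_sum_card_fiberwise (f := fun w => c v w) (t := X)]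
  · refine sum_congr rfl fun z hz => ?_
    rw [colorDegree, filter_filter]
    congr 1
    refine filter_congr fun w _ => ?_
    constructor
    · rintro ⟨h, rfl⟩; exact ⟨⟨h, hz⟩, rfl⟩
    · rintro ⟨⟨h, _⟩, h'⟩; exact ⟨h, h'⟩
  · intro w hw
    simp only [coe_filter, mem_univ, true_and, Set.mem_ofPred_eq] at hw
    exact hw.2

/-- If the color of `pu` is the only one that may be less frequent at `p` than at `q`, up to one
edge of color `m`, then the edge `pu` can be given the color of `qu` without changing any color
degree or destroying an edge of color `m`. Otherwise the colors from which `c p u` cannot be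
reached, `c q u` among them, would be more frequent at `q` than at `p`. -/
theorem exists_recoloring_of_degree_le [Fintype C] (hc : ∀ x y, c x y = c y x) {m : C}
    (hpq : p ≠ q) (hup : u ≠ p) (huq : u ≠ q)
    (hqm : c q u ≠ m) (hm0 : colorDegree c p m = 0) (hm1 : colorDegree c q m ≤ 1)
    (hf : colorDegree c q (c q u) + 1 ≤ colorDegree c p (c q u))
    (hz : ∀ z, z ≠ c q u → z ≠ m → z ≠ c p u → colorDegree c q z ≤ colorDegree c p z) :
    ∃ c' : V → V → C, (∀ x y, c' x y = c' y x) ∧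
      (∀ v z, colorDegree c' v z = colorDegree c v z) ∧ c' p u = c q u ∧
      ∀ x y, x ≠ y → c x y = m → c' x y = m := by
  obtain ⟨T, hT0, hT1, hT2⟩ := exists_backward_closed c p q (c p u)
  have hfT : c q u ∈ T := by
    by_contra hfT
    have h1 : ∑ z ∈ Tᶜ, colorDegree c q z ≤ ∑ z ∈ Tᶜ, colorDegree c p z := by
      have hle : ∀ z ∈ Tᶜ, colorDegree c q z + (if z = c q u then 1 else 0) ≤
          colorDegree c p z + (if z = m then 1 else 0) := by
        intro z hzT
        have hzu : z ≠ c p u := fun e => (mem_compl.1 hzT) (e ▸ hT0)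
        by_cases h1 : z = c q u
        · subst h1; simp [hqm]; exact hf
        by_cases h2 : z = m
        · subst h2; simp [h1]; omega
        · simpa [h1, h2] using hz z h1 h2 hzu
      have := sum_le_sum hle
      rw [sum_add_distrib, sum_add_distrib, sum_ite_eq' _ (c q u),
        if_pos (mem_compl.2 hfT), sum_ite_eq'] at this
      split_ifs at this <;> omega
    rw [sum_colorDegree, sum_colorDegree] at h1
    -- No arc leaves the complement of `T`, and the arc at `u` enters it. The edge `pq` itself counts
    -- on both sides, which is why the vertices are matched up by `swap p q`.
    refine absurd h1 (not_le.2 ?_)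
    rw [← card_image_of_injective _ (Equiv.swap p q).injective]
    refine card_lt_card ((ssubset_iff_of_subset fun w hw => ?_).2 ⟨u, ?_, ?_⟩)
    · obtain ⟨x, hx, rfl⟩ := mem_image.1 hw
      simp only [mem_filter, mem_univ, true_and, mem_compl] at hx ⊢
      by_cases hxq : x = q
      · subst hxq
        rw [Equiv.swap_apply_right]
        exact ⟨hpq, hc x p ▸ hx.2⟩
      · rw [Equiv.swap_apply_of_ne_of_ne hx.1 hxq]
        exact ⟨hxq, fun h => hx.2 (hT2 x hx.1 hxq h)⟩
    · simp [huq, hfT]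
    · intro h
      obtain ⟨x, hx, hxu⟩ := mem_image.1 h
      have : x = u := by
        rw [← Equiv.swap_apply_of_ne_of_ne hup huq] at hxu
        exact (Equiv.swap p q).injective hxu
      subst this
      simp only [mem_filter, mem_univ, true_and, mem_compl] at hx
      exact hx.2 hT0
  obtain ⟨W, hW1, hW2⟩ := hT1 _ hfT
  have huW : u ∉ W := fun h => (hW1 u h).2.2.2 rfl
  refine exists_recoloring_of_balanced hc (W := insert u W) hpq ?_ ?_ (mem_insert_self _ _) ?_ hm0
  · rw [mem_insert, not_or]; exact ⟨hup.symm, fun h => (hW1 p h).1 rfl⟩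
  · rw [mem_insert, not_or]; exact ⟨huq.symm, fun h => (hW1 q h).2.1 rfl⟩
  · intro z
    have := hW2 z
    rw [filter_insert, filter_insert]
    have n1 : u ∉ ({x ∈ W | c p x = z} : Finset V) := fun h => huW (mem_filter.1 h).1
    have n2 : u ∉ ({x ∈ W | c q x = z} : Finset V) := fun h => huW (mem_filter.1 h).1
    rw [apply_ite card, apply_ite card, card_insert_of_notMem n1, card_insert_of_notMem n2]
    simp only [eq_comm (a := z)] at this ⊢
    split_ifs at this ⊢ <;> omega

end Switching

/-! ### Monochromatic diagonals on a torus -/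

section Parity

lemma sum_range_succ_of_periodic {M : Type*} [AddCommGroup M] {m : ℕ} {g : ℕ → M}
    (hg : g m = g 0) : ∑ i ∈ range m, g (i + 1) = ∑ i ∈ range m, g i := by
  have := sum_range_succ g m
  rw [sum_range_succ' g m, hg] at this
  exact add_right_cancel this

/-- In a two-colored quadrangulated torus `C_m × C_n` with `m` and `n` odd, some square has both of
its diagonals monochromatic. Over `𝔽₂`, the indicator of such squares sums to `mn = 1`, as all
other terms cancel after shifting the indices. -/
theorem exists_square_diagonals_eq {m n : ℕ} (hm : Odd m) (hn : Odd n) (t : ℕ → ℕ → ZMod 2)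
    (h1 : ∀ i j, t (i + m) j = t i j) (h2 : ∀ i j, t i (j + n) = t i j) :
    ∃ i j, t i j = t (i + 1) (j + 1) ∧ t (i + 1) j = t i (j + 1) := by
  by_contra! hno
  have hzero : ∀ i j, (1 + t i j + t (i + 1) (j + 1)) * (1 + t (i + 1) j + t i (j + 1)) = 0 := by
    intro i j
    have := hno i j
    generalize t i j = a at *
    generalize t (i + 1) (j + 1) = b at *
    generalize t (i + 1) j = c at *
    generalize t i (j + 1) = d at *
    revert a b c d
    decide
  have shift_left : ∀ g : ℕ → ℕ → ZMod 2, (∀ j, g m j = g 0 j) →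
      ∑ i ∈ range m, ∑ j ∈ range n, g (i + 1) j = ∑ i ∈ range m, ∑ j ∈ range n, g i j :=
    fun g hg => sum_range_succ_of_periodic (g := fun i => ∑ j ∈ range n, g i j) (by simp [hg])
  have shift_right : ∀ g : ℕ → ℕ → ZMod 2, (∀ i, g i n = g i 0) →
      ∑ i ∈ range m, ∑ j ∈ range n, g i (j + 1) = ∑ i ∈ range m, ∑ j ∈ range n, g i j :=
    fun g hg => sum_congr rfl fun i _ => sum_range_succ_of_periodic (hg i)
  have hm0 : ∀ j, t m j = t 0 j := fun j => by simpa using h1 0 j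
  have hm1 : ∀ j, t (m + 1) j = t 1 j := fun j => by simpa [add_comm] using h1 1 j
  have hn0 : ∀ i, t i n = t i 0 := fun i => by simpa using h2 i 0
  have hn1 : ∀ i, t i (n + 1) = t i 1 := fun i => by simpa [add_comm] using h2 i 1
  have e1 := shift_left t hm0
  have e2 := shift_right t hn0
  have e3 := shift_left (fun i j => t i (j + 1)) (fun j => hm0 _)
  have e4 := shift_left (fun i j => t i j * t i (j + 1)) (fun j => by simp [hm0])
  have e5 := shift_right (fun i j => t i j * t (i + 1) j) (fun i => by simp [hn0])
  have total : ∑ i ∈ range m, ∑ j ∈ range n,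
      (1 + t i j + t (i + 1) (j + 1)) * (1 + t (i + 1) j + t i (j + 1)) = 0 :=
    sum_eq_zero fun i _ => sum_eq_zero fun j _ => hzero i j
  have expand : ∀ i j, (1 + t i j + t (i + 1) (j + 1)) * (1 + t (i + 1) j + t i (j + 1)) =
      1 + (t i j + t (i + 1) j) + (t i (j + 1) + t (i + 1) (j + 1)) +
      (t i j * t i (j + 1) + t (i + 1) j * t (i + 1) (j + 1)) +
      (t i j * t (i + 1) j + t i (j + 1) * t (i + 1) (j + 1)) := fun i j => by ring
  simp only [expand, sum_add_distrib] at total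
  rw [e1, e2, e3, e2, e4, e5] at total
  simp only [CharTwo.add_self_eq_zero, add_zero, sum_const, card_range, nsmul_eq_mul, mul_one]
    at total
  rw [ZMod.natCast_eq_one_iff_odd.2 hm, ZMod.natCast_eq_one_iff_odd.2 hn] at total
  simp at total

end Parity

/-! ### Merging and splitting color classes -/

section Recoloring

variable {V C : Type*} [Fintype V] [DecidableEq V] [DecidableEq C]
variable {c c' : V → V → C} {f m : C}

lemma colorDegree_congr {v : V} (h : ∀ w, w ≠ v → c v w = c' v w) (z : C) :
    colorDegree c v z = colorDegree c' v z := by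
  unfold colorDegree
  congr 1
  refine filter_congr fun w _ => ?_
  constructor <;> rintro ⟨h1, h2⟩ <;> refine ⟨h1, ?_⟩ <;> simpa [h w h1] using h2

/-- The coloring in which the edges of color `m` have been given the color `f`. -/
def mergeColor (c : V → V → C) (f m : C) : V → V → C := fun x y =>
  if c x y = m then f else c x y

lemma colorDegree_mergeColor_of_ne {z : C} (hf : z ≠ f) (hm : z ≠ m) (v : V) :
    colorDegree (mergeColor c f m) v z = colorDegree c v z := by
  unfold colorDegree
  congr 1
  refine filter_congr fun w _ => ?_
  unfold mergeColor
  split_ifs with h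
  · simp [h, hf.symm, hm.symm]
  · rfl

lemma colorDegree_mergeColor_left (hfm : f ≠ m) (v : V) :
    colorDegree (mergeColor c f m) v f = colorDegree c v f + colorDegree c v m := by
  unfold colorDegree
  rw [← card_union_of_disjoint]
  · congr 1
    ext w
    simp only [mem_filter, mem_union, mem_univ, true_and]
    unfold mergeColor
    split_ifs with h <;> simp only [h]
    · simp; tauto
    · tauto
  · rw [disjoint_filter]
    rintro w - ⟨_, h⟩ ⟨_, h'⟩
    exact hfm (h.symm.trans h')

lemma colorDegree_mergeColor_right (hfm : f ≠ m) (v : V) :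
    colorDegree (mergeColor c f m) v m = 0 := by
  unfold colorDegree
  rw [card_eq_zero, filter_eq_empty_iff]
  rintro w - ⟨_, h⟩
  unfold mergeColor at h
  split_ifs at h with h'
  · exact hfm h
  · exact h' h

/-- The coloring in which the edges joining a vertex to its image under `ρ` have been given the
color `m`. -/
def permColor (c : V → V → C) (ρ : Equiv.Perm V) (m : C) : V → V → C := fun x y =>
  if ρ x = y ∨ ρ y = x then m else c x y

variable {ρ : Equiv.Perm V}

lemma permColor_symm (hc : ∀ x y, c x y = c y x) (x y : V) :
    permColor c ρ m x y = permColor c ρ m y x := by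
  unfold permColor
  rw [hc x y]
  simp only [or_comm]

lemma permColor_of_ne (hc : ∀ x y, c x y = c y x) (hρ : ∀ w, ρ w ≠ w → c w (ρ w) = f) {x y : V}
    (hxy : x ≠ y) (h : c x y ≠ f) : permColor c ρ m x y = c x y := by
  unfold permColor
  refine if_neg ?_
  rintro (rfl | rfl)
  · exact h (hρ _ hxy.symm)
  · rw [hc] at h; exact h (hρ _ hxy)

lemma permColor_of_fixed {x y : V} (hx : ρ x = x) (hxy : x ≠ y) :
    permColor c ρ m x y = c x y := by
  unfold permColor
  refine if_neg ?_
  rintro (h | h)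
  · exact hxy (hx.symm.trans h)
  · rw [← hx] at h; exact hxy (by simpa using (ρ.injective h).symm)

lemma mergeColor_permColor (hc : ∀ x y, c x y = c y x) (hm : ∀ v, colorDegree c v m = 0)
    (hρ : ∀ w, ρ w ≠ w → c w (ρ w) = f) {x y : V} (hxy : y ≠ x) :
    mergeColor (permColor c ρ m) f m x y = c x y := by
  unfold mergeColor permColor
  by_cases h : ρ x = y ∨ ρ y = x
  · rw [if_pos h, if_pos rfl]
    rcases h with rfl | rfl
    · exact (hρ _ hxy).symm
    · rw [hc]; exact (hρ _ hxy.symm).symm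
  · rw [if_neg h, if_neg (ne_of_colorDegree_eq_zero (hm x) hxy)]

lemma colorDegree_permColor_of_ne (hc : ∀ x y, c x y = c y x) (hm : ∀ v, colorDegree c v m = 0)
    (hρ : ∀ w, ρ w ≠ w → c w (ρ w) = f) {z : C} (hzf : z ≠ f) (hzm : z ≠ m) (v : V) :
    colorDegree (permColor c ρ m) v z = colorDegree c v z := by
  rw [← colorDegree_mergeColor_of_ne hzf hzm (c := permColor c ρ m)]
  exact colorDegree_congr (fun w hw => mergeColor_permColor hc hm hρ hw) z

lemma colorDegree_permColor_add (hc : ∀ x y, c x y = c y x) (hm : ∀ v, colorDegree c v m = 0)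
    (hfm : f ≠ m) (hρ : ∀ w, ρ w ≠ w → c w (ρ w) = f) (v : V) :
    colorDegree (permColor c ρ m) v f + colorDegree (permColor c ρ m) v m = colorDegree c v f := by
  rw [← colorDegree_mergeColor_left hfm]
  exact colorDegree_congr (fun w hw => mergeColor_permColor hc hm hρ hw) f

lemma colorDegree_permColor_of_fixed {v : V} (hm : colorDegree c v m = 0) (hv : ρ v = v) :
    colorDegree (permColor c ρ m) v m = 0 := by
  rw [← hm]
  exact colorDegree_congr (fun w hw => permColor_of_fixed hv hw.symm) m

lemma colorDegree_permColor_of_involution {v : V} (hm : colorDegree c v m = 0) (hv : ρ v ≠ v)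
    (hv2 : ρ (ρ v) = v) : colorDegree (permColor c ρ m) v m = 1 := by
  unfold colorDegree
  rw [card_eq_one]
  refine ⟨ρ v, ?_⟩
  ext w
  simp only [mem_filter, mem_univ, true_and, mem_singleton]
  unfold permColor
  constructor
  · rintro ⟨hw, h⟩
    split_ifs at h with h'
    · rcases h' with h' | h'
      · exact h'.symm
      · exact ρ.injective (h'.trans hv2.symm)
    · exact absurd h (ne_of_colorDegree_eq_zero hm hw)
  · rintro rfl
    simp [hv]

/-- By Hall's theorem, the edges of a color in which all vertices have the same positive degree
contain a union of disjoint edges and cycles covering all vertices, given as the orbits of a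
permutation. -/
lemma exists_perm_of_regular (hc : ∀ x y, c x y = c y x) {K : ℕ} (hK : 0 < K)
    (hf : ∀ v, colorDegree c v f = K) :
    ∃ σ : Equiv.Perm V, ∀ w, σ w ≠ w ∧ c w (σ w) = f := by
  set t : V → Finset V := fun v => {w | w ≠ v ∧ c v w = f} with ht
  have hall : ∀ s : Finset V, #s ≤ #(s.biUnion t) := by
    intro s
    have hcount : #s * K ≤ #(s.biUnion t) * K := by
      refine card_mul_le_card_mul (fun v w => w ∈ t v) (fun v hv => ?_) (fun w _ => ?_)
      · rw [← hf v]
        refine card_le_card fun w hw => ?_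
        rw [bipartiteAbove, mem_filter]
        exact ⟨mem_biUnion.2 ⟨v, hv, hw⟩, hw⟩
      · rw [← hf w]
        refine card_le_card fun v hv => ?_
        rw [bipartiteBelow, mem_filter] at hv
        have := hv.2
        simp only [ht, mem_filter, mem_univ, true_and] at this ⊢
        exact ⟨this.1.symm, hc w v ▸ this.2⟩
    exact Nat.le_of_mul_le_mul_right hcount hK
  obtain ⟨g, hg, hgt⟩ := (all_card_le_biUnion_card_iff_exists_injective t).1 hall
  refine ⟨Equiv.ofBijective g (Finite.injective_iff_bijective.1 hg), fun w => ?_⟩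
  simpa [ht] using hgt w

end Recoloring

/-! ### Matchings in the cycles of a permutation -/

section Cycles

variable {V : Type*} [Fintype V] [DecidableEq V]

lemma glue_perm {D : V → Prop} (σ ρ : Equiv.Perm V)
    (hσ : ∀ w, D (σ w) ↔ D w) (hρ : ∀ w, D (ρ w) ↔ D w) :
    ∃ τ : Equiv.Perm V, (∀ w, D w → τ w = ρ w) ∧ ∀ w, ¬ D w → τ w = σ w := by
  classical
  have hinj : Function.Injective fun w => if D w then ρ w else σ w := by
    intro x y hxy
    by_cases hx : D x <;> by_cases hy : D y <;> simp only [hx, hy, if_true, if_false] at hxy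
    · exact ρ.injective hxy
    · exact absurd ((hσ y).1 (hxy ▸ (hρ x).2 hx)) hy
    · exact absurd ((hσ x).1 (hxy ▸ (hρ y).2 hy)) hx
    · exact σ.injective hxy
  exact ⟨Equiv.ofBijective _ (Finite.injective_iff_bijective.1 hinj),
    fun w hw => by simp [hw], fun w hw => by simp [hw]⟩

/-- The perfect matching of the path `s, σ s, …, σ ^ (2 * k - 1) s`, as an involution that is the
identity off the path. -/
lemma exists_path_pairing (σ : Equiv.Perm V) (s : V) (k : ℕ)
    (hinj : ∀ i j, i < 2 * k → j < 2 * k → (σ ^ i) s = (σ ^ j) s → i = j) :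
    ∃ ρ : Equiv.Perm V,
      (∀ i < 2 * k, ρ (ρ ((σ ^ i) s)) = (σ ^ i) s ∧ ρ ((σ ^ i) s) ≠ (σ ^ i) s ∧
        (ρ ((σ ^ i) s) = σ ((σ ^ i) s) ∨ σ (ρ ((σ ^ i) s)) = (σ ^ i) s)) ∧
      ∀ w, (∀ i < 2 * k, w ≠ (σ ^ i) s) → ρ w = w := by
  induction k with
  | zero => exact ⟨1, by simp, by simp⟩
  | succ k ih =>
    obtain ⟨ρ, h1, h2⟩ := ih fun i j hi hj => hinj i j (by omega) (by omega)
    set x := (σ ^ (2 * k)) s with hx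
    have hy : σ x = (σ ^ (2 * k + 1)) s := by rw [pow_succ', Equiv.Perm.mul_apply]
    have hne : ∀ i < 2 * k, (σ ^ i) s ≠ x ∧ (σ ^ i) s ≠ σ x := fun i hi =>
      ⟨fun e => by have := hinj _ _ (by omega) (by omega) e; omega,
       fun e => by rw [hy] at e; have := hinj _ _ (by omega) (by omega) e; omega⟩
    have hxy : x ≠ σ x := fun e => by
      rw [hy] at e; have := hinj _ _ (by omega) (by omega) e; omega
    have hρx : ρ x = x := h2 x fun i hi e => (hne i hi).1 e.symm
    have hρy : ρ (σ x) = σ x := h2 _ fun i hi e => (hne i hi).2 e.symm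
    have hswap : ∀ w, w ≠ x → w ≠ σ x → (ρ * Equiv.swap x (σ x)) w = ρ w := fun w e1 e2 => by
      rw [Equiv.Perm.mul_apply, Equiv.swap_apply_of_ne_of_ne e1 e2]
    have hswx : (ρ * Equiv.swap x (σ x)) x = σ x := by simp [hρy]
    have hswy : (ρ * Equiv.swap x (σ x)) (σ x) = x := by simp [hρx]
    refine ⟨ρ * Equiv.swap x (σ x), fun i hi => ?_, fun w hw => ?_⟩
    · rcases lt_or_ge i (2 * k) with hi' | hi'
      · obtain ⟨a1, a2⟩ := hne i hi'
        have b1 : ρ ((σ ^ i) s) ≠ x := fun e => a1 (ρ.injective (e.trans hρx.symm))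
        have b2 : ρ ((σ ^ i) s) ≠ σ x := fun e => a2 (ρ.injective (e.trans hρy.symm))
        rw [hswap _ a1 a2, hswap _ b1 b2]
        exact h1 i hi'
      · rcases (show i = 2 * k ∨ i = 2 * k + 1 by omega) with rfl | rfl
        · rw [← hx, hswx, hswy]; exact ⟨rfl, hxy.symm, Or.inl rfl⟩
        · rw [← hy, hswy, hswx]; exact ⟨rfl, hxy, Or.inr rfl⟩
    · rw [hswap w (hw _ (by omega)) (hy ▸ hw _ (by omega))]
      exact h2 w fun i hi => hw i (by omega)

lemma pow_injOn_minimalPeriod (σ : Equiv.Perm V) (s : V) {i j : ℕ}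
    (hi : i < Function.minimalPeriod σ s) (hj : j < Function.minimalPeriod σ s)
    (h : (σ ^ i) s = (σ ^ j) s) : i = j := by
  rw [← Equiv.Perm.iterate_eq_pow, ← Equiv.Perm.iterate_eq_pow] at h
  exact Function.iterate_injOn_Iio_minimalPeriod hi hj h

lemma minimalPeriod_pos (σ : Equiv.Perm V) (s : V) : 0 < Function.minimalPeriod σ s :=
  Function.minimalPeriod_pos_of_mem_periodicPts (σ.injective.mem_periodicPts s)

lemma pow_minimalPeriod_add (σ : Equiv.Perm V) (s : V) (i : ℕ) :
    (σ ^ (i + Function.minimalPeriod σ s)) s = (σ ^ i) s := by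
  rw [← Equiv.Perm.iterate_eq_pow, ← Equiv.Perm.iterate_eq_pow, Function.iterate_add_minimalPeriod_eq]

lemma exists_pow_of_sameCycle {σ : Equiv.Perm V} {s w : V} (h : σ.SameCycle s w) :
    ∃ i < Function.minimalPeriod σ s, (σ ^ i) s = w := by
  obtain ⟨i, hi⟩ := h.exists_nat_pow_eq
  refine ⟨i % Function.minimalPeriod σ s, Nat.mod_lt _ (minimalPeriod_pos σ s), ?_⟩
  rw [← Equiv.Perm.iterate_eq_pow, Function.iterate_mod_minimalPeriod_eq,
    Equiv.Perm.iterate_eq_pow, hi]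

lemma sameCycle_of_adjacent {σ : Equiv.Perm V} {u w x : V} (h : x = σ w ∨ σ x = w) :
    σ.SameCycle u x ↔ σ.SameCycle u w := by
  rcases h with rfl | rfl <;> simp

/-- The perfect matching of an even cycle of `σ`. -/
lemma exists_even_cycle_pairing (σ : Equiv.Perm V) (u : V)
    (hu : Even (Function.minimalPeriod σ u)) :
    ∃ ρ : Equiv.Perm V, (∀ w, σ.SameCycle u w → ρ (ρ w) = w ∧ ρ w ≠ w ∧
      (ρ w = σ w ∨ σ (ρ w) = w)) ∧ ∀ w, ¬ σ.SameCycle u w → ρ w = w := by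
  obtain ⟨k, hk⟩ := hu
  obtain ⟨ρ, h1, h2⟩ := exists_path_pairing σ u k fun i j hi hj =>
    pow_injOn_minimalPeriod σ u (by omega) (by omega)
  refine ⟨ρ, fun w hw => ?_, fun w hw => h2 w fun i _ e => hw (e ▸ ⟨i, by simp⟩)⟩
  obtain ⟨i, hi, rfl⟩ := exists_pow_of_sameCycle hw
  exact h1 i (by omega)

/-- The matching of an odd cycle of `σ` that misses only the vertex `u`. -/
lemma exists_odd_cycle_pairing (σ : Equiv.Perm V) (u : V)
    (hu : Odd (Function.minimalPeriod σ u)) :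
    ∃ ρ : Equiv.Perm V, ρ u = u ∧ (∀ w, σ.SameCycle u w → w ≠ u → ρ (ρ w) = w ∧ ρ w ≠ w ∧
      (ρ w = σ w ∨ σ (ρ w) = w)) ∧ ∀ w, ¬ σ.SameCycle u w → ρ w = w := by
  obtain ⟨k, hk⟩ := hu
  have hpow : ∀ i, (σ ^ i) (σ u) = (σ ^ (i + 1)) u := fun i => by
    rw [pow_succ, Equiv.Perm.mul_apply]
  obtain ⟨ρ, h1, h2⟩ := exists_path_pairing σ (σ u) k fun i j hi hj h => by
    rw [hpow, hpow] at h
    have := pow_injOn_minimalPeriod σ u (by omega) (by omega) h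
    omega
  refine ⟨ρ, h2 u fun i hi e => ?_, fun w hw hwu => ?_, fun w hw => h2 w fun i _ e => ?_⟩
  · rw [hpow] at e
    have := pow_injOn_minimalPeriod σ u (i := 0) (by omega) (by omega) e
    omega
  · obtain ⟨i, hi, rfl⟩ := exists_pow_of_sameCycle hw
    obtain _ | i := i
    · exact absurd rfl hwu
    · rw [← hpow]; exact h1 i (by omega)
  · rw [hpow] at e; exact hw (e ▸ ⟨(i + 1 : ℕ), by rw [zpow_natCast]⟩)

end Cycles

/-! ### Minimal covers by edges and cycles -/

section MinimalCover

variable {V C : Type*} [Fintype V] [DecidableEq V] [DecidableEq C]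

/-- The edges of color `f` contain a cover of the vertices by disjoint edges and cycles, the orbits
of `σ`, and among all such covers in colorings with the same color degrees, this one has the fewest
vertices on cycles of length at least three. The color `m` is unused. -/
structure IsMinimalCover (c : V → V → C) (f m : C) (σ : Equiv.Perm V) : Prop where
  symm : ∀ x y, c x y = c y x
  unused : ∀ v, colorDegree c v m = 0
  cover : ∀ w, σ w ≠ w ∧ c w (σ w) = f
  minimal : ∀ (c' : V → V → C) (σ' : Equiv.Perm V), (∀ x y, c' x y = c' y x) →
    (∀ v z, colorDegree c' v z = colorDegree c v z) →
    (∀ w, σ' w ≠ w ∧ c' w (σ' w) = f) → #{w | σ (σ w) ≠ w} ≤ #{w | σ' (σ' w) ≠ w}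

variable {c : V → V → C} {f m : C} {σ : Equiv.Perm V}

namespace IsMinimalCover

/-- No competing cover has all vertices of long cycles among those of `σ`, and one fewer. -/
lemma false_of_lt (h : IsMinimalCover c f m σ) {c' : V → V → C} {σ' : Equiv.Perm V}
    (hc' : ∀ x y, c' x y = c' y x)
    (hdeg : ∀ v z, colorDegree c' v z = colorDegree c v z)
    (hσ' : ∀ w, σ' w ≠ w ∧ c' w (σ' w) = f) {u : V} (hu : σ (σ u) ≠ u) (hu' : σ' (σ' u) = u)
    (hle : ∀ w, σ' (σ' w) = w ∨ σ' (σ' w) = σ (σ w)) : False := by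
  refine absurd (h.minimal c' σ' hc' hdeg hσ') (not_le.2 (card_lt_card ?_))
  refine (ssubset_iff_of_subset fun w hw => ?_).2 ⟨u, by simpa using hu, by simpa using hu'⟩
  simp only [mem_filter, mem_univ, true_and] at hw ⊢
  rcases hle w with h1 | h1
  · exact absurd h1 hw
  · exact h1 ▸ hw

lemma color_apply (h : IsMinimalCover c f m σ) {w x : V} (hx : x = σ w ∨ σ x = w) :
    c w x = f := by
  rcases hx with rfl | rfl
  · exact (h.cover w).2
  · rw [h.symm]; exact (h.cover x).2

lemma odd_minimalPeriod (h : IsMinimalCover c f m σ) {u : V} (hu : σ (σ u) ≠ u) :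
    Odd (Function.minimalPeriod σ u) := by
  by_contra hodd
  obtain ⟨ρ, h1, h2⟩ := exists_even_cycle_pairing σ u (Nat.not_odd_iff_even.1 hodd)
  have hρD : ∀ w, σ.SameCycle u (ρ w) ↔ σ.SameCycle u w := by
    intro w
    by_cases hw : σ.SameCycle u w
    · exact sameCycle_of_adjacent (h1 w hw).2.2
    · rw [h2 w hw]
  obtain ⟨τ, t1, t2⟩ := glue_perm (D := σ.SameCycle u) σ ρ (fun w => by simp) hρD
  have hττ : ∀ w, σ.SameCycle u w → τ (τ w) = w := fun w hw => by
    rw [t1 w hw, t1 _ ((hρD w).2 hw), (h1 w hw).1]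
  refine h.false_of_lt h.symm (fun _ _ => rfl) (fun w => ?_) hu
    (hττ u (Equiv.Perm.SameCycle.refl σ u)) fun w => ?_
  · by_cases hw : σ.SameCycle u w
    · rw [t1 w hw]; exact ⟨(h1 w hw).2.1, h.color_apply (h1 w hw).2.2⟩
    · rw [t2 w hw]; exact h.cover w
  · by_cases hw : σ.SameCycle u w
    · exact Or.inl (hττ w hw)
    · refine Or.inr ?_
      rw [t2 w hw, t2 (σ w) (by simpa using hw)]

end IsMinimalCover

lemma card_sameCycle (σ : Equiv.Perm V) (u : V) [DecidablePred (σ.SameCycle u)] :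
    #{w | σ.SameCycle u w} = Function.minimalPeriod σ u := by
  rw [← card_range (Function.minimalPeriod σ u), eq_comm]
  refine card_bij (fun i _ => (σ ^ i) u) (fun i _ => ?_) (fun i hi j hj e => ?_) fun w hw => ?_
  · exact mem_filter.2 ⟨mem_univ _, i, by rw [zpow_natCast]⟩
  · exact pow_injOn_minimalPeriod σ u (mem_range.1 hi) (mem_range.1 hj) e
  · obtain ⟨i, hi, e⟩ := exists_pow_of_sameCycle (mem_filter.1 hw).2
    exact ⟨i, mem_range.2 hi, e⟩

/-- The odd cycles of a permutation of a set of even size cannot be a single one. -/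
lemma exists_other_long_cycle (hV : Even (Fintype.card V)) (hσ : ∀ w, σ w ≠ w) {u : V}
    (hu : Odd (Function.minimalPeriod σ u)) : ∃ v, ¬ σ.SameCycle u v ∧ σ (σ v) ≠ v := by
  classical
  by_contra! hno
  have heven : ((#{w | ¬ σ.SameCycle u w} : ℕ) : ZMod 2) = 0 := by
    rw [card_eq_sum_ones, Nat.cast_sum]
    refine sum_involution (fun w _ => σ w) (fun w _ => by decide) (fun w _ _ => hσ w)
      (fun w hw => ?_) fun w hw => ?_
    · simpa using hw
    · exact hno w (mem_filter.1 hw).2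
  have hsum := card_filter_add_card_filter_not (s := (univ : Finset V)) (σ.SameCycle u)
  rw [card_sameCycle, card_univ] at hsum
  rw [← hsum] at hV
  have : ((Function.minimalPeriod σ u + #{w | ¬ σ.SameCycle u w} : ℕ) : ZMod 2) = 0 :=
    (ZMod.natCast_eq_zero_iff_even).2 hV
  rw [Nat.cast_add, heven, add_zero, ZMod.natCast_eq_one_iff_odd.2 hu] at this
  exact one_ne_zero this

/-- Two odd cycles of `σ` can be replaced by a matching missing only the vertices `u` and `v`. -/
lemma exists_two_odd_cycles_pairing {u v : V} (huv : ¬ σ.SameCycle u v)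
    (hσ : ∀ w, σ w ≠ w)
    (hu : Odd (Function.minimalPeriod σ u)) (hv : Odd (Function.minimalPeriod σ v)) :
    ∃ ρ : Equiv.Perm V, ρ u = u ∧ ρ v = v ∧
      (∀ w, w ≠ u → w ≠ v → ρ w ≠ w ∧ (ρ w = σ w ∨ σ (ρ w) = w)) ∧
      (∀ w, σ.SameCycle u w ∨ σ.SameCycle v w → ρ (ρ w) = w) ∧
      ∀ w, ρ (ρ w) = w ∨ ρ (ρ w) = σ (σ w) := by
  obtain ⟨ρ₁, a0, a1, a2⟩ := exists_odd_cycle_pairing σ u hu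
  obtain ⟨ρ₂, b0, b1, b2⟩ := exists_odd_cycle_pairing σ v hv
  have hdisj : ∀ w, σ.SameCycle u w → ¬ σ.SameCycle v w := fun w h1 h2 => huv (h1.trans h2.symm)
  have hρ₁ : ∀ w, σ.SameCycle u (ρ₁ w) ↔ σ.SameCycle u w := by
    intro w
    by_cases hw : σ.SameCycle u w
    · by_cases hwu : w = u
      · rw [hwu, a0]
      · exact sameCycle_of_adjacent (a1 w hw hwu).2.2
    · rw [a2 w hw]
  have hρ₂ : ∀ w, σ.SameCycle v (ρ₂ w) ↔ σ.SameCycle v w := by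
    intro w
    by_cases hw : σ.SameCycle v w
    · by_cases hwv : w = v
      · rw [hwv, b0]
      · exact sameCycle_of_adjacent (b1 w hw hwv).2.2
    · rw [b2 w hw]
  obtain ⟨τ, t1, t2⟩ := glue_perm (D := σ.SameCycle u) σ ρ₁ (fun w => by simp) hρ₁
  have hτ : ∀ w, σ.SameCycle v (τ w) ↔ σ.SameCycle v w := by
    intro w
    by_cases hw : σ.SameCycle u w
    · rw [t1 w hw]
      exact iff_of_false (hdisj _ ((hρ₁ w).2 hw)) (hdisj _ hw)
    · rw [t2 w hw]; simp
  obtain ⟨ρ, r1, r2⟩ := glue_perm (D := σ.SameCycle v) τ ρ₂ hτ hρ₂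
  have hU : ∀ w, σ.SameCycle u w → ρ w = ρ₁ w := fun w hw => by
    rw [r2 w (hdisj w hw), t1 w hw]
  have hN : ∀ w, ¬ σ.SameCycle u w → ¬ σ.SameCycle v w → ρ w = σ w := fun w h1 h2 => by
    rw [r2 w h2, t2 w h1]
  have hinv : ∀ w, σ.SameCycle u w ∨ σ.SameCycle v w → ρ (ρ w) = w := by
    rintro w (hw | hw)
    · rw [hU w hw, hU _ ((hρ₁ w).2 hw)]
      by_cases hwu : w = u
      · rw [hwu, a0, a0]
      · exact (a1 w hw hwu).1
    · rw [r1 w hw, r1 _ ((hρ₂ w).2 hw)]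
      by_cases hwv : w = v
      · rw [hwv, b0, b0]
      · exact (b1 w hw hwv).1
  refine ⟨ρ, ?_, ?_, fun w hwu hwv => ?_, hinv, fun w => ?_⟩
  · rw [hU u (Equiv.Perm.SameCycle.refl σ u), a0]
  · rw [r1 v (Equiv.Perm.SameCycle.refl σ v), b0]
  · by_cases h1 : σ.SameCycle u w
    · rw [hU w h1]; exact (a1 w h1 hwu).2
    by_cases h2 : σ.SameCycle v w
    · rw [r1 w h2]; exact (b1 w h2 hwv).2
    · rw [hN w h1 h2]; exact ⟨hσ w, Or.inl rfl⟩
  · by_cases h1 : σ.SameCycle u w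
    · exact Or.inl (hinv w (Or.inl h1))
    by_cases h2 : σ.SameCycle v w
    · exact Or.inl (hinv w (Or.inr h2))
    · refine Or.inr ?_
      rw [hN w h1 h2, hN _ (by simpa using h1) (by simpa using h2)]

/-- In a minimal cover, let `u` and `v` lie on different long cycles, which are then odd. With the
edges of a matching of these cycles missing only `u` and `v` put in the color `m`, as well as the
edges of the other cycles, no coloring with the same degrees that keeps the edges of color `m` has
`uv` in color `f`. -/
lemma IsMinimalCover.exists_rigid (h : IsMinimalCover c f m σ) (hfm : f ≠ m) {u v : V}
    (huv : ¬ σ.SameCycle u v) (hu : σ (σ u) ≠ u) (hv : σ (σ v) ≠ v) :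
    ∃ ρ : Equiv.Perm V, ρ u = u ∧ ρ v = v ∧ (∀ w, ρ w ≠ w → c w (ρ w) = f) ∧
      (∀ w, w ≠ u → w ≠ v → σ.SameCycle u w ∨ σ.SameCycle v w → ρ w ≠ w ∧ ρ (ρ w) = w) ∧
      ∀ c' : V → V → C, (∀ x y, c' x y = c' y x) →
        (∀ w z, colorDegree c' w z = colorDegree (permColor c ρ m) w z) →
        (∀ x y, x ≠ y → permColor c ρ m x y = m → c' x y = m) → c' u v ≠ f := by
  have hne : u ≠ v := fun e => huv (e ▸ Equiv.Perm.SameCycle.refl σ u)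
  obtain ⟨ρ, hρu, hρv, h1, hinv, h2⟩ := exists_two_odd_cycles_pairing huv (fun w => (h.cover w).1)
    (h.odd_minimalPeriod hu) (h.odd_minimalPeriod hv)
  have hρf : ∀ w, ρ w ≠ w → c w (ρ w) = f := fun w hw =>
    h.color_apply (h1 w (fun e => hw (e ▸ hρu)) (fun e => hw (e ▸ hρv))).2
  refine ⟨ρ, hρu, hρv, hρf, fun w hwu hwv hw => ⟨(h1 w hwu hwv).1, hinv w hw⟩, ?_⟩
  intro c' hc' hdeg hm' huv'
  have hcomp : ∀ w, w ≠ u → w ≠ v → (ρ * Equiv.swap u v) w = ρ w := fun w e1 e2 => by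
    rw [Equiv.Perm.mul_apply, Equiv.swap_apply_of_ne_of_ne e1 e2]
  have hcu : (ρ * Equiv.swap u v) u = v := by simp [hρv]
  have hcv : (ρ * Equiv.swap u v) v = u := by simp [hρu]
  refine h.false_of_lt (c' := mergeColor c' f m) (σ' := ρ * Equiv.swap u v)
    (fun x y => by unfold mergeColor; rw [hc' x y]) (fun w z => ?_) (fun w => ?_) hu
    (by rw [hcu, hcv]) fun w => ?_
  · by_cases hzm : z = m
    · rw [hzm, colorDegree_mergeColor_right hfm, h.unused]
    by_cases hzf : z = f
    · rw [hzf, colorDegree_mergeColor_left hfm, hdeg, hdeg,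
        colorDegree_permColor_add h.symm h.unused hfm hρf]
    · rw [colorDegree_mergeColor_of_ne hzf hzm, hdeg,
        colorDegree_permColor_of_ne h.symm h.unused hρf hzf hzm]
  · by_cases hwu : w = u
    · rw [hwu, hcu]
      exact ⟨hne.symm, by unfold mergeColor; rw [huv', if_neg hfm]⟩
    by_cases hwv : w = v
    · rw [hwv, hcv]
      exact ⟨hne, by unfold mergeColor; rw [hc', huv', if_neg hfm]⟩
    · rw [hcomp w hwu hwv]
      refine ⟨(h1 w hwu hwv).1, ?_⟩
      unfold mergeColor
      rw [if_pos (hm' _ _ (h1 w hwu hwv).1.symm (if_pos (Or.inl rfl)))]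
  · by_cases hwu : w = u
    · left; rw [hwu, hcu, hcv]
    by_cases hwv : w = v
    · left; rw [hwv, hcv, hcu]
    · have e1 : ρ w ≠ u := fun e => hwu (ρ.injective (e.trans hρu.symm))
      have e2 : ρ w ≠ v := fun e => hwv (ρ.injective (e.trans hρv.symm))
      rw [hcomp w hwu hwv, hcomp _ e1 e2]
      exact h2 w

end MinimalCover

/-! ### Extracting a perfect matching -/

section Extraction

variable {V C : Type*} [Fintype V] [DecidableEq V] [Fintype C] [DecidableEq C]
variable {c : V → V → C} {f m : C} {σ : Equiv.Perm V} {u v x y : V}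

namespace IsMinimalCover

/-- An edge of color `f` between two long cycles already contradicts minimality. -/
lemma color_ne (h : IsMinimalCover c f m σ) (hfm : f ≠ m) (huv : ¬ σ.SameCycle u v)
    (hu : σ (σ u) ≠ u) (hv : σ (σ v) ≠ v) : c u v ≠ f := by
  obtain ⟨ρ, hρu, -, -, -, hrigid⟩ := h.exists_rigid hfm huv hu hv
  have hne : u ≠ v := fun e => huv (e ▸ Equiv.Perm.SameCycle.refl σ u)
  rw [← permColor_of_fixed (c := c) (m := m) hρu hne]
  exact hrigid _ (permColor_symm h.symm) (fun _ _ => rfl) fun _ _ _ h => h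

/-- Since the two-vertex exchange at `v` and `y` cannot put `uv` in color `f`, some color is more
frequent at `y` than at `v`. -/
lemma exists_colorDegree_lt (h : IsMinimalCover c f m σ) (hfm : f ≠ m) {K : ℕ}
    (hK : ∀ w, colorDegree c w f = K) (huv : ¬ σ.SameCycle u v)
    (hu : σ (σ u) ≠ u) (hv : σ (σ v) ≠ v) (huy : u = σ y ∨ σ u = y) :
    ∃ z, z ≠ f ∧ z ≠ m ∧ z ≠ c u v ∧ colorDegree c v z < colorDegree c y z := by
  by_contra! hz
  obtain ⟨ρ, hρu, hρv, hρf, hinv, hrigid⟩ := h.exists_rigid hfm huv hu hv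
  have hsy : σ.SameCycle u y :=
    (sameCycle_of_adjacent huy).1 (Equiv.Perm.SameCycle.refl σ u)
  have hne : u ≠ v := fun e => huv (e ▸ Equiv.Perm.SameCycle.refl σ u)
  have hyu : u ≠ y := by
    rcases huy with e | e
    · rw [e]; exact (h.cover y).1
    · rw [← e]; exact (h.cover u).1.symm
  have hvy : v ≠ y := fun e => huv (e ▸ hsy)
  obtain ⟨i1, i2⟩ := hinv y hyu.symm hvy.symm (Or.inl hsy)
  have hyuf : permColor c ρ m y u = f := by
    rw [permColor_symm h.symm, permColor_of_fixed hρu hyu, h.symm, h.color_apply huy]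
  have hvu : permColor c ρ m v u = c u v := by
    rw [permColor_of_fixed hρv hne.symm, h.symm]
  have hmv := colorDegree_permColor_of_fixed (ρ := ρ) (h.unused v) hρv
  have hmy := colorDegree_permColor_of_involution (h.unused y) i1 i2
  have hfv := colorDegree_permColor_add h.symm h.unused hfm hρf v
  have hfy := colorDegree_permColor_add h.symm h.unused hfm hρf y
  rw [hK] at hfv hfy
  obtain ⟨c', c1, c2, c3, c4⟩ := exists_recoloring_of_degree_le (c := permColor c ρ m) (m := m)
    (permColor_symm h.symm) hvy hne hyu (by rw [hyuf]; exact hfm) hmv hmy.le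
    (by rw [hyuf]; omega) (fun z z1 z2 z3 => by
      rw [hyuf] at z1
      rw [hvu] at z3
      rw [colorDegree_permColor_of_ne h.symm h.unused hρf z1 z2,
        colorDegree_permColor_of_ne h.symm h.unused hρf z1 z2]
      exact hz z z1 z2 z3)
  exact hrigid c' c1 c2 c4 (by rw [c1, c3, hyuf])

/-- Exchanging the two colors on the 4-cycle `u v x y` would put `uv` in color `f`. -/
lemma color_ne_opposite (h : IsMinimalCover c f m σ) (hfm : f ≠ m) (huv : ¬ σ.SameCycle u v)
    (hu : σ (σ u) ≠ u) (hv : σ (σ v) ≠ v) (huy : u = σ y ∨ σ u = y) (hvx : v = σ x ∨ σ v = x)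
    (hf : c u v ≠ f) : c u v ≠ c y x := by
  intro heq
  obtain ⟨ρ, hρu, hρv, hρf, -, hrigid⟩ := h.exists_rigid hfm huv hu hv
  have hsy : σ.SameCycle u y :=
    (sameCycle_of_adjacent huy).1 (Equiv.Perm.SameCycle.refl σ u)
  have hsx : σ.SameCycle v x :=
    (sameCycle_of_adjacent hvx).1 (Equiv.Perm.SameCycle.refl σ v)
  have hne : u ≠ v := fun e => huv (e ▸ Equiv.Perm.SameCycle.refl σ u)
  have hyu : u ≠ y := by
    rcases huy with e | e
    · rw [e]; exact (h.cover y).1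
    · rw [← e]; exact (h.cover u).1.symm
  have hxv : v ≠ x := by
    rcases hvx with e | e
    · rw [e]; exact (h.cover x).1
    · rw [← e]; exact (h.cover v).1.symm
  have hvy : v ≠ y := fun e => huv (e ▸ hsy)
  have hux : u ≠ x := fun e => huv (e ▸ hsx.symm)
  have hyx : y ≠ x := fun e => huv (hsy.trans (e ▸ hsx.symm))
  have k1 : permColor c ρ m y u = f := by
    rw [permColor_symm h.symm, permColor_of_fixed hρu hyu, h.symm, h.color_apply huy]
  have k2 : permColor c ρ m v u = c u v := by
    rw [permColor_of_fixed hρv hne.symm, h.symm]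
  have k3 : permColor c ρ m v x = f := by
    rw [permColor_of_fixed hρv hxv, h.symm, h.color_apply hvx]
  have k4 : permColor c ρ m y x = c u v := by
    rw [permColor_of_ne h.symm hρf hyx (heq ▸ hf), heq]
  obtain ⟨c', c1, c2, c3, c4⟩ := exists_recoloring_of_balanced (c := permColor c ρ m) (m := m)
    (W := {u, x}) (permColor_symm h.symm) hvy (u := u) (by simp [hne.symm, hxv])
    (by simp [hyu.symm, hyx]) (by simp) (fun z => by
      rw [filter_insert, filter_insert, filter_singleton, filter_singleton, k1, k2, k3, k4]
      split_ifs <;> simp [hux])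
    (colorDegree_permColor_of_fixed (h.unused v) hρv)
  exact hrigid c' c1 c2 c4 (by rw [c1, c3, k1])

/-- If the degrees in color `a` compare the same way across the two diagonals, no two-vertex
exchange being possible forces `uv` to have one of the colors other than `a`, `b`, `f`, `m`. -/
lemma color_notMem (h : IsMinimalCover c f m σ) (hfm : f ≠ m) {K : ℕ}
    (hK : ∀ w, colorDegree c w f = K) {a b : C} (ham : a ≠ m) (hbm : b ≠ m)
    (hab : ∀ w w', colorDegree c w a + colorDegree c w b =
      colorDegree c w' a + colorDegree c w' b)
    (hreg : ∀ z, z ≠ a → z ≠ b → z ≠ f → z ≠ m → ∀ w w', colorDegree c w z = colorDegree c w' z)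
    (huv : ¬ σ.SameCycle u v)
    (hu : σ (σ u) ≠ u) (hv : σ (σ v) ≠ v) (huy : u = σ y ∨ σ u = y) (hvx : v = σ x ∨ σ v = x)
    (hd : colorDegree c v a < colorDegree c y a ↔ colorDegree c x a < colorDegree c u a) :
    c u v ≠ a ∧ c u v ≠ b ∧ c u v ≠ f ∧ c u v ≠ m := by
  have hne : u ≠ v := fun e => huv (e ▸ Equiv.Perm.SameCycle.refl σ u)
  obtain ⟨z, z1, z2, z3, z4⟩ := h.exists_colorDegree_lt hfm hK huv hu hv huy
  obtain ⟨z', z1', z2', z3', z4'⟩ := h.exists_colorDegree_lt hfm hK (fun e => huv e.symm) hv hu hvx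
  rw [h.symm] at z3'
  have hz : z = a ∨ z = b := by
    by_contra! hno
    exact absurd z4 (hreg z hno.1 hno.2 z1 z2 v y).not_lt
  have hz' : z' = a ∨ z' = b := by
    by_contra! hno
    exact absurd z4' (hreg z' hno.1 hno.2 z1' z2' u x).not_lt
  have hvy := hab v y
  have hux := hab u x
  refine ⟨fun e => ?_, fun e => ?_, h.color_ne hfm huv hu hv,
    ne_of_colorDegree_eq_zero (h.unused u) hne.symm⟩
  · obtain rfl := hz.resolve_left fun e' => z3 (e'.trans e.symm)
    obtain rfl := hz'.resolve_left fun e' => z3' (e'.trans e.symm)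
    omega
  · obtain rfl := hz.resolve_right fun e' => z3 (e'.trans e.symm)
    obtain rfl := hz'.resolve_right fun e' => z3' (e'.trans e.symm)
    omega

end IsMinimalCover

lemma ne_of_colorDegree_le_one {z : C} (h : colorDegree c u z ≤ 1) (hv : v ≠ u) (hx : x ≠ u)
    (hvx : v ≠ x) (hz : c u v = z) : c u v ≠ c u x := fun e => by
  have := card_le_one.1 h v (by simp [hv, hz]) x (by simp [hx, ← e, hz])
  exact hvx this

/-- A minimal cover consists of disjoint edges. Otherwise it has two odd cycles, and some square
formed by an edge of either has both diagonals monochromatic for the comparison of the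
`a`-degrees. The four edges of `K_V` between these two edges then have four different colors
among those other than `a`, `b`, `f`, `m`, and there are only three of these. -/
theorem IsMinimalCover.involutive (h : IsMinimalCover c f m σ) (hV : Even (Fintype.card V))
    (hC : Fintype.card C ≤ 7) {K : ℕ} (hK : ∀ w, colorDegree c w f = K) {a b : C} (habne : a ≠ b)
    (haf : a ≠ f) (hbf : b ≠ f) (ham : a ≠ m) (hbm : b ≠ m) (hfm : f ≠ m)
    (hab : ∀ w w', colorDegree c w a + colorDegree c w b =
      colorDegree c w' a + colorDegree c w' b)
    (hreg : ∀ z, z ≠ a → z ≠ b → z ≠ f → z ≠ m → ∀ w w', colorDegree c w z = colorDegree c w' z)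
    (hone : ∀ z, z ≠ a → z ≠ b → z ≠ f → z ≠ m → ∀ w, colorDegree c w z ≤ 1) (w : V) :
    σ (σ w) = w := by
  by_contra hw
  have hodd := h.odd_minimalPeriod hw
  obtain ⟨w', hww', hw'⟩ := exists_other_long_cycle hV (fun x => (h.cover x).1) hodd
  have hodd' := h.odd_minimalPeriod hw'
  obtain ⟨i, j, e1, e2⟩ := exists_square_diagonals_eq hodd hodd'
    (fun i j => if colorDegree c ((σ ^ j) w') a < colorDegree c ((σ ^ i) w) a then 1 else 0)
    (fun i j => by simp only [pow_minimalPeriod_add]) fun i j => by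
      simp only [pow_minimalPeriod_add]
  have hiff : ∀ P Q : Prop, ∀ [Decidable P] [Decidable Q],
      (if P then (1 : ZMod 2) else 0) = (if Q then 1 else 0) → (P ↔ Q) := by
    intro P Q _ _ e
    by_cases hP : P <;> by_cases hQ : Q <;> simp_all
  replace e1 := hiff _ _ e1
  replace e2 := hiff _ _ e2
  have hlong : ∀ (x : V) (i : ℕ), σ (σ x) ≠ x → σ (σ ((σ ^ i) x)) ≠ (σ ^ i) x := by
    intro x i hx e
    refine hx ((σ ^ i).injective ?_)
    have hcomm : ∀ y, (σ ^ i) (σ y) = σ ((σ ^ i) y) := fun y => by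
      rw [← Equiv.Perm.mul_apply, ← Equiv.Perm.mul_apply, pow_mul_comm']
    rw [hcomm, hcomm, e]
  have hcyc : ∀ i j, ¬ σ.SameCycle ((σ ^ i) w) ((σ ^ j) w') := fun i j => by simpa using hww'
  have hne : ∀ i j, (σ ^ i) w ≠ (σ ^ j) w' := fun i j e =>
    hcyc i j (e ▸ Equiv.Perm.SameCycle.refl σ _)
  have hu0 := hlong w i hw
  have hu1 := hlong w (i + 1) hw
  have hv0 := hlong w' j hw'
  have hv1 := hlong w' (j + 1) hw'
  have h00 := hcyc i j
  have h01 := hcyc i (j + 1)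
  have h10 := hcyc (i + 1) j
  have h11 := hcyc (i + 1) (j + 1)
  have n00 := hne i j
  have n01 := hne i (j + 1)
  have n10 := hne (i + 1) j
  have n11 := hne (i + 1) (j + 1)
  have hu : σ ((σ ^ i) w) = (σ ^ (i + 1)) w := by rw [pow_succ', Equiv.Perm.mul_apply]
  have hv : σ ((σ ^ j) w') = (σ ^ (j + 1)) w' := by rw [pow_succ', Equiv.Perm.mul_apply]
  generalize (σ ^ i) w = u at *
  generalize (σ ^ (i + 1)) w = y at *
  generalize (σ ^ j) w' = v at *
  generalize (σ ^ (j + 1)) w' = x at *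
  have huy : u ≠ y := hu ▸ (h.cover u).1.symm
  have hvx : v ≠ x := hv ▸ (h.cover v).1.symm
  -- The condition on the degrees for one diagonal of the square concerns the signs on the other.
  obtain ⟨p1, p2, p3, p4⟩ := h.color_notMem hfm hK ham hbm hab hreg h00 hu0 hv0 (Or.inr hu)
    (Or.inr hv) e2
  obtain ⟨q1, q2, q3, q4⟩ := h.color_notMem hfm hK ham hbm hab hreg h01 hu0 hv1 (Or.inr hu)
    (Or.inl hv.symm) e1.symm
  obtain ⟨r1, r2, r3, r4⟩ := h.color_notMem hfm hK ham hbm hab hreg h10 hu1 hv0 (Or.inl hu.symm)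
    (Or.inr hv) e1
  obtain ⟨s1, s2, s3, s4⟩ := h.color_notMem hfm hK ham hbm hab hreg h11 hu1 hv1 (Or.inl hu.symm)
    (Or.inl hv.symm) e2.symm
  have d1 : c u v ≠ c y x := h.color_ne_opposite hfm h00 hu0 hv0 (Or.inr hu) (Or.inr hv) p3
  have d2 : c u x ≠ c y v := h.color_ne_opposite hfm h01 hu0 hv1 (Or.inr hu) (Or.inl hv.symm) q3
  have d3 : c u v ≠ c u x :=
    ne_of_colorDegree_le_one (hone _ p1 p2 p3 p4 u) n00.symm n01.symm hvx rfl
  have d4 : c y v ≠ c y x :=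
    ne_of_colorDegree_le_one (hone _ r1 r2 r3 r4 y) n10.symm n11.symm hvx rfl
  have d5 : c u v ≠ c y v := by
    rw [h.symm u v, h.symm y v]
    exact ne_of_colorDegree_le_one (hone _ p1 p2 p3 p4 v) n00 n10 huy (h.symm v u)
  have d6 : c u x ≠ c y x := by
    rw [h.symm u x, h.symm y x]
    exact ne_of_colorDegree_le_one (hone _ q1 q2 q3 q4 x) n01 n11 huy (h.symm x u)
  have hnodup : [a, b, f, m, c u v, c u x, c y v, c y x].Nodup := by
    simp [habne, haf, hbf, ham, hbm, hfm, p1.symm, p2.symm, p3.symm, p4.symm, q1.symm, q2.symm,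
      q3.symm, q4.symm, r1.symm, r2.symm, r3.symm, r4.symm, s1.symm, s2.symm, s3.symm, s4.symm,
      d1, d2, d3, d4, d5, d6]
  have hlength := hnodup.length_le_card
  simp only [List.length_cons, List.length_nil] at hlength
  omega

lemma exists_isMinimalCover (hc : ∀ x y, c x y = c y x) {K : ℕ} (hK0 : 0 < K)
    (hK : ∀ w, colorDegree c w f = K) (hm : ∀ w, colorDegree c w m = 0) :
    ∃ (c' : V → V → C) (σ : Equiv.Perm V), IsMinimalCover c' f m σ ∧
      ∀ v z, colorDegree c' v z = colorDegree c v z := by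
  classical
  obtain ⟨σ, hσ⟩ := exists_perm_of_regular hc hK0 hK
  let S : Set ((V → V → C) × Equiv.Perm V) := {s | (∀ x y, s.1 x y = s.1 y x) ∧
    (∀ v z, colorDegree s.1 v z = colorDegree c v z) ∧ ∀ w, s.2 w ≠ w ∧ s.1 w (s.2 w) = f}
  obtain ⟨s, hs, hmin⟩ := Set.Finite.exists_minimalFor
    (fun s : (V → V → C) × Equiv.Perm V => #{w | s.2 (s.2 w) ≠ w}) S (Set.toFinite S) ⟨(c, σ), hc, fun _ _ => rfl, hσ⟩
  refine ⟨s.1, s.2, ⟨hs.1, fun v => (hs.2.1 v m).trans (hm v), hs.2.2, ?_⟩, hs.2.1⟩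
  intro c' σ' h1 h2 h3
  rcases le_total (#{w | s.2 (s.2 w) ≠ w}) (#{w | σ' (σ' w) ≠ w}) with hle | hle
  · exact hle
  · exact hmin (j := (c', σ')) ⟨h1, fun v z => (h2 v z).trans (hs.2.1 v z), h3⟩ hle

/-- In a coloring with at most seven colors, in which all colors but `a`, `b`, `f` form matchings
and `m` is unused, a perfect matching can be moved from `f` to `m` after a recoloring that keeps
all color degrees. -/
theorem exists_extraction (hc : ∀ x y, c x y = c y x) (hV : Even (Fintype.card V))
    (hC : Fintype.card C ≤ 7) {K : ℕ} (hK : ∀ w, colorDegree c w f = K + 1)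
    (hm : ∀ w, colorDegree c w m = 0) {a b : C} (habne : a ≠ b)
    (haf : a ≠ f) (hbf : b ≠ f) (ham : a ≠ m) (hbm : b ≠ m) (hfm : f ≠ m)
    (hab : ∀ w w', colorDegree c w a + colorDegree c w b =
      colorDegree c w' a + colorDegree c w' b)
    (hreg : ∀ z, z ≠ a → z ≠ b → z ≠ f → z ≠ m → ∀ w w', colorDegree c w z = colorDegree c w' z)
    (hone : ∀ z, z ≠ a → z ≠ b → z ≠ f → z ≠ m → ∀ w, colorDegree c w z ≤ 1) :
    ∃ c' : V → V → C, (∀ x y, c' x y = c' y x) ∧ (∀ w, colorDegree c' w f = K) ∧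
      (∀ w, colorDegree c' w m = 1) ∧
      ∀ z, z ≠ f → z ≠ m → ∀ w, colorDegree c' w z = colorDegree c w z := by
  obtain ⟨c₁, σ, h, hdeg⟩ := exists_isMinimalCover hc K.succ_pos hK hm
  simp only [← hdeg] at hK hab hreg hone ⊢
  have hinv := h.involutive hV hC hK habne haf hbf ham hbm hfm hab hreg hone
  have hσ : ∀ w, σ w ≠ w → c₁ w (σ w) = f := fun w _ => (h.cover w).2
  have hone' : ∀ w, colorDegree (permColor c₁ σ m) w m = 1 := fun w =>
    colorDegree_permColor_of_involution (h.unused w) (h.cover w).1 (hinv w)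
  refine ⟨permColor c₁ σ m, permColor_symm h.symm, fun w => ?_, hone', fun z z1 z2 w =>
    colorDegree_permColor_of_ne h.symm h.unused hσ z1 z2 w⟩
  have := colorDegree_permColor_add h.symm h.unused hfm hσ w
  rw [hone', hK] at this
  omega

end Extraction

/-! ### Kundu's theorem -/

section Packing

variable {V : Type*} [Fintype V] [DecidableEq V]

lemma colorDegree_add_colorDegree (A B : V → V → Bool) (v : V) :
    colorDegree A v true + colorDegree B v true =
      ∑ w ∈ univ.erase v, ((A v w).toNat + (B v w).toNat) := by
  have key : ∀ D : V → V → Bool,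
      colorDegree D v true = ∑ w ∈ univ.erase v, (D v w).toNat := by
    intro D
    rw [colorDegree, card_filter, ← sum_subset (erase_subset v univ)]
    · refine sum_congr rfl fun w hw => ?_
      cases h : D v w <;> simp [ne_of_mem_erase hw]
    · intro w _ hw
      have : w = v := by simpa using hw
      simp [this]
  rw [key, key, sum_add_distrib]

/-- The pairs that are edges of both `A` and `B`. -/
def commonPairs (A B : V → V → Bool) : Finset (V × V) :=
  {e | e.1 ≠ e.2 ∧ A e.1 e.2 = true ∧ B e.1 e.2 = true}

/-- Moving two edges `xy`, `zw` of `A` to `xz`, `yw`, where `xz` belongs to neither graph, removes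
the common edge `xy`. A new common edge `yw` replaces the common edge `zw`. -/
lemma card_commonPairs_pairSwitch_lt {A B : V → V → Bool} (hA : ∀ x y, A x y = A y x)
    (hB : ∀ x y, B x y = B y x) {x y z w : V} (hxy : x ≠ y) (hxz : x ≠ z) (hyz : y ≠ z)
    (hwx : w ≠ x) (hwy : w ≠ y) (hwz : w ≠ z) (a1 : A x y = true) (b1 : B x y = true)
    (a2 : A x z = false) (b2 : B x z = false) (a3 : A y w = false) (a4 : A z w = true)
    (hb : B y w = true → B z w = true) :
    #(commonPairs (pairSwitch A y z {x, w}) B) < #(commonPairs A B) := by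
  have e1 : pairSwitch A y z {x, w} y w = true := by
    simp [pairSwitch, hxy.symm, hwy.symm, a4]
  have e2 : pairSwitch A y z {x, w} z w = false := by
    simp [pairSwitch, hxz.symm, hwz.symm, a3]
  have e3 : pairSwitch A y z {x, w} y x = false := by
    simp [pairSwitch, hxy.symm, hwy.symm, hA z x, a2]
  have hsymm : ∀ s t, pairSwitch A y z {x, w} s t = pairSwitch A y z {x, w} t s :=
    fun s t => hA _ _
  have hother : ∀ s t, s ≠ t → B s t = true → ¬ (s = y ∧ t = w) → ¬ (s = w ∧ t = y) →
      pairSwitch A y z {x, w} s t = true → A s t = true ∧ ¬ (s = x ∧ t = y) := by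
    intro s t hst hBst n1 n2 h
    have nxy : ¬ (s = x ∧ t = y) := by
      rintro ⟨rfl, rfl⟩
      rw [hsymm, e3] at h; cases h
    have nyx : ¬ (s = y ∧ t = x) := by
      rintro ⟨rfl, rfl⟩
      rw [e3] at h; cases h
    have nzx : ¬ (s = z ∧ t = x) := by
      rintro ⟨rfl, rfl⟩
      rw [hB, b2] at hBst; cases hBst
    have nxz : ¬ (s = x ∧ t = z) := by
      rintro ⟨rfl, rfl⟩
      rw [b2] at hBst; cases hBst
    have nzw : ¬ (s = z ∧ t = w) := by
      rintro ⟨rfl, rfl⟩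
      rw [e2] at h; cases h
    have nwz : ¬ (s = w ∧ t = z) := by
      rintro ⟨rfl, rfl⟩
      rw [hsymm, e2] at h; cases h
    refine ⟨?_, nxy⟩
    have f1 : (if t ∈ ({x, w} : Finset V) then Equiv.swap y z s else s) = s := by
      split_ifs with ht
      · replace ht : t = x ∨ t = w := by simpa using ht
        exact Equiv.swap_apply_of_ne_of_ne
          (fun e => ht.elim (fun k => nyx ⟨e, k⟩) fun k => n1 ⟨e, k⟩)
          (fun e => ht.elim (fun k => nzx ⟨e, k⟩) fun k => nzw ⟨e, k⟩)
      · rfl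
    have f2 : (if s ∈ ({x, w} : Finset V) then Equiv.swap y z t else t) = t := by
      split_ifs with hs
      · replace hs : s = x ∨ s = w := by simpa using hs
        exact Equiv.swap_apply_of_ne_of_ne
          (fun e => hs.elim (fun k => nxy ⟨k, e⟩) fun k => n2 ⟨k, e⟩)
          (fun e => hs.elim (fun k => nxz ⟨k, e⟩) fun k => nwz ⟨k, e⟩)
      · rfl
    unfold pairSwitch at h
    rwa [f1, f2] at h
  have hmem : (x, y) ∈ commonPairs A B := by simp [commonPairs, hxy, a1, b1]
  refine lt_of_le_of_lt ?_ (card_erase_lt_of_mem hmem)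
  refine card_le_card_of_injOn
    (fun e => if e = (y, w) then (z, w) else if e = (w, y) then (w, z) else e) ?_ ?_
  · rintro ⟨s, t⟩ he
    simp only [commonPairs, coe_filter, mem_univ, true_and, Set.mem_ofPred_eq] at he
    obtain ⟨hst, h1, h2⟩ := he
    rw [mem_coe, mem_erase]
    by_cases c1 : s = y ∧ t = w
    · obtain ⟨rfl, rfl⟩ := c1
      simp [commonPairs, hwz.symm, a4, hb h2, hxz.symm]
    by_cases c2 : s = w ∧ t = y
    · obtain ⟨rfl, rfl⟩ := c2
      rw [hB] at h2
      simp [commonPairs, hwz, hwy, hA s z, hB s z, a4, hb h2, hwx]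
    · have := hother s t hst h2 c1 c2 h1
      simp only [Prod.mk.injEq, c1, c2, if_false]
      simp only [commonPairs, mem_filter, mem_univ, true_and]
      exact ⟨by simpa using this.2, hst, this.1, h2⟩
  · have hz1 : (z, w) ∉ commonPairs (pairSwitch A y z {x, w}) B := by simp [commonPairs, e2]
    have hz2 : (w, z) ∉ commonPairs (pairSwitch A y z {x, w}) B := by
      simp [commonPairs, hsymm w z, e2]
    intro e he e' he' h
    have g1 : e ≠ (z, w) := fun k => hz1 (k ▸ he)
    have g2 : e ≠ (w, z) := fun k => hz2 (k ▸ he)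
    have g3 : e' ≠ (z, w) := fun k => hz1 (k ▸ he')
    have g4 : e' ≠ (w, z) := fun k => hz2 (k ▸ he')
    have g5 : (z, w) ≠ (w, z) := by simp [hwz]
    dsimp only at h
    split_ifs at h <;> simp_all

/-- Kundu's theorem as a packing theorem: two graphs whose degrees have a constant sum less than
the number of vertices have edge-disjoint realizations. When they have a fewest possible number of
common edges and `xy` is one, some `xz` is in neither graph, and comparing the degrees of `y` and
`z` gives a switch that decreases the number. -/
theorem exists_packing {A B : V → V → Bool} (hA : ∀ x y, A x y = A y x)
    (hB : ∀ x y, B x y = B y x) {N : ℕ} (hN : N < Fintype.card V)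
    (hdeg : ∀ v, colorDegree A v true + colorDegree B v true = N) :
    ∃ A' B' : V → V → Bool, (∀ x y, A' x y = A' y x) ∧ (∀ x y, B' x y = B' y x) ∧
      (∀ v, colorDegree A' v true = colorDegree A v true) ∧
      (∀ v, colorDegree B' v true = colorDegree B v true) ∧
      ∀ x y, x ≠ y → A' x y = true → B' x y = false := by
  induction hk : #(commonPairs A B) using Nat.strong_induction_on generalizing A B with
  | _ k ih =>
  subst hk
  by_cases hno : ∀ x y, x ≠ y → A x y = true → B x y = false
  · exact ⟨A, B, hA, hB, fun _ => rfl, fun _ => rfl, hno⟩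
  push Not at hno
  obtain ⟨x, y, hxy, a1, b1⟩ := hno
  replace b1 : B x y = true := by simpa using b1
  have hsum : ∀ v, ∑ w ∈ univ.erase v, ((A v w).toNat + (B v w).toNat) = N := fun v => by
    rw [← colorDegree_add_colorDegree, hdeg]
  obtain ⟨z, hxz, a2, b2⟩ : ∃ z, x ≠ z ∧ A x z = false ∧ B x z = false := by
    by_contra! hall
    have hlt : ∑ w ∈ univ.erase x, 1 < ∑ w ∈ univ.erase x, ((A x w).toNat + (B x w).toNat) := by
      refine sum_lt_sum (fun w hw => ?_) ⟨y, by simp [hxy.symm], by simp [a1, b1]⟩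
      have := hall w (ne_of_mem_erase hw).symm
      cases hAw : A x w <;> cases hBw : B x w <;> simp_all
    rw [hsum, sum_const, card_erase_of_mem (mem_univ x), card_univ, smul_eq_mul, mul_one] at hlt
    omega
  have hyz : y ≠ z := by
    rintro rfl
    rw [a1] at a2; cases a2
  obtain ⟨w, hwx, hwy, hwz, hw⟩ : ∃ w, w ≠ x ∧ w ≠ y ∧ w ≠ z ∧
      (A y w).toNat + (B y w).toNat < (A z w).toNat + (B z w).toNat := by
    by_contra! hall
    have hswap : ∑ w ∈ univ.erase z, ((A z w).toNat + (B z w).toNat) =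
        ∑ w ∈ univ.erase y,
          ((A z (Equiv.swap y z w)).toNat + (B z (Equiv.swap y z w)).toNat) := by
      refine sum_equiv (Equiv.swap y z) (fun w => ?_) fun w _ => by simp
      rw [mem_erase, mem_erase, ← not_iff_not]
      simp only [mem_univ, and_true, not_not]
      rw [← (Equiv.swap y z).apply_eq_iff_eq (x := w), Equiv.swap_apply_right]
    have hlt : ∑ w ∈ univ.erase y,
        ((A z (Equiv.swap y z w)).toNat + (B z (Equiv.swap y z w)).toNat) <
        ∑ w ∈ univ.erase y, ((A y w).toNat + (B y w).toNat) := by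
      refine sum_lt_sum (fun w hw => ?_) ⟨x, by simp [hxy], ?_⟩
      · have hwy := ne_of_mem_erase hw
        by_cases hwz : w = z
        · rw [hwz, Equiv.swap_apply_right, hA z y, hB z y]
        rw [Equiv.swap_apply_of_ne_of_ne hwy hwz]
        by_cases hwx : w = x
        · rw [hwx, hA z x, hB z x, a2, b2]; simp
        · exact hall w hwx hwy hwz
      · rw [Equiv.swap_apply_of_ne_of_ne hxy hxz, hA z x, hB z x, a2, b2, hA y x, hB y x, a1, b1]
        simp
    rw [← hswap, hsum, hsum] at hlt
    exact lt_irrefl _ hlt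
  have hbal : ∀ D : V → V → Bool, (∀ s t, D s t = D t s) → D x y = true → D x z = false →
      D y w = false → D z w = true →
      ∀ v s, colorDegree (pairSwitch D y z {x, w}) v s = colorDegree D v s := by
    intro D hD d1 d2 d3 d4
    refine colorDegree_pairSwitch hyz (by simp [hxy.symm, hwy.symm])
      (by simp [hxz.symm, hwz.symm]) fun s => ?_
    rw [filter_insert, filter_insert, filter_singleton, filter_singleton, hD y x, hD z x, d1, d2,
      d3, d4]
    cases s <;> simp
  have hcases : (A y w = false ∧ A z w = true ∧ (B y w = true → B z w = true)) ∨
      (B y w = false ∧ B z w = true ∧ (A y w = true → A z w = true)) := by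
    generalize A y w = p at *
    generalize B y w = q at *
    generalize A z w = r at *
    generalize B z w = s at *
    revert p q r s
    decide
  rcases hcases with ⟨a3, a4, hb⟩ | ⟨b3, b4, ha⟩
  · have hD := hbal A hA a1 a2 a3 a4
    obtain ⟨A', B', h1, h2, h3, h4, h5⟩ := ih _ (card_commonPairs_pairSwitch_lt hA hB hxy hxz hyz
      hwx hwy hwz a1 b1 a2 b2 a3 a4 hb) (A := pairSwitch A y z {x, w}) (B := B)
      (fun s t => hA _ _) hB (fun v => by rw [hD, hdeg]) rfl
    exact ⟨A', B', h1, h2, fun v => (h3 v).trans (hD v true), h4, h5⟩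
  · have hD := hbal B hB b1 b2 b3 b4
    have hcomm : ∀ D E : V → V → Bool, commonPairs D E = commonPairs E D := fun D E => by
      unfold commonPairs
      refine filter_congr fun e _ => ?_
      tauto
    obtain ⟨A', B', h1, h2, h3, h4, h5⟩ := ih _ (by
      rw [hcomm A, hcomm A]
      exact card_commonPairs_pairSwitch_lt hB hA hxy hxz hyz hwx hwy hwz b1 a1 b2 a2 b3 b4 ha)
      (A := A) (B := pairSwitch B y z {x, w})
      hA (fun s t => hB _ _) (fun v => by rw [hD, hdeg]) rfl
    exact ⟨A', B', h1, h2, h3, fun v => (h4 v).trans (hD v true), h5⟩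

end Packing

/-! ### From colorings to factors -/

section Assembly

variable {V C : Type*} [Fintype V] [DecidableEq V] [DecidableEq C]

/-- The graph formed by the edges of color `z`. -/
def colorClass (c : V → V → C) (hc : ∀ x y, c x y = c y x) (z : C) : SimpleGraph V where
  Adj x y := x ≠ y ∧ c x y = z
  symm := ⟨fun x y h => ⟨h.1.symm, hc x y ▸ h.2⟩⟩
  loopless := ⟨fun _ h => h.1 rfl⟩

lemma degree_colorClass (c : V → V → C) (hc : ∀ x y, c x y = c y x) (z : C) (v : V)
    [Fintype ((colorClass c hc z).neighborSet v)] :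
    (colorClass c hc z).degree v = colorDegree c v z := by
  rw [← SimpleGraph.card_neighborFinset_eq_degree, colorDegree]
  congr 1
  ext w
  simp only [SimpleGraph.mem_neighborFinset, mem_filter, mem_univ, true_and]
  exact ⟨fun h => ⟨h.1.symm, h.2⟩, fun h => ⟨h.1.symm, h.2⟩⟩

lemma colorDegree_decide_adj (G : SimpleGraph V) [DecidableRel G.Adj] (v : V)
    [Fintype (G.neighborSet v)] :
    colorDegree (fun x y => decide (G.Adj x y)) v true = G.degree v := by
  rw [← SimpleGraph.card_neighborFinset_eq_degree, colorDegree]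
  congr 1
  ext w
  simp only [mem_filter, mem_univ, true_and, decide_eq_true_eq, SimpleGraph.mem_neighborFinset]
  exact ⟨fun h => h.2, fun h => ⟨h.ne', h⟩⟩

/-- Colors `inl 0` and `inl 1` are two edge-disjoint graphs, color `inl 2` consists of the other
edges, and the four colors `inr j` are unused. -/
lemma exists_initial_coloring {A B : V → V → Bool} (hA : ∀ x y, A x y = A y x)
    (hB : ∀ x y, B x y = B y x) {k : ℕ}
    (hdeg : ∀ v, colorDegree A v true + colorDegree B v true + k + 1 = Fintype.card V) :
    ∃ c : V → V → Fin 3 ⊕ Fin 4, (∀ x y, c x y = c y x) ∧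
      (∀ v, colorDegree c v (.inl 0) = colorDegree A v true) ∧
      (∀ v, colorDegree c v (.inl 1) = colorDegree B v true) ∧
      (∀ v, colorDegree c v (.inl 2) = k) ∧
      ∀ v j, colorDegree c v (.inr j) = 0 := by
  rcases isEmpty_or_nonempty V with hV | ⟨⟨v₀⟩⟩
  · exact ⟨fun _ _ => .inl 0, fun _ _ => rfl, isEmptyElim, isEmptyElim, isEmptyElim, isEmptyElim⟩
  obtain ⟨A', B', hA', hB', dA, dB, hdisj⟩ := exists_packing hA hB
    (N := Fintype.card V - 1 - k) (by have := hdeg v₀; omega) fun v => by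
      have := hdeg v; omega
  let c : V → V → Fin 3 ⊕ Fin 4 := fun x y =>
    if A' x y then .inl 0 else if B' x y then .inl 1 else .inl 2
  have h0 : ∀ v, colorDegree c v (.inl 0) = colorDegree A v true := fun v => by
    rw [← dA, colorDegree, colorDegree]
    congr 1
    refine filter_congr fun w _ => ?_
    cases h1 : A' v w <;> cases h2 : B' v w <;> simp [c, h1, h2]
  have h1 : ∀ v, colorDegree c v (.inl 1) = colorDegree B v true := fun v => by
    rw [← dB, colorDegree, colorDegree]
    congr 1
    refine filter_congr fun w _ => ?_
    by_cases hw : w = v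
    · simp [hw]
    have := hdisj v w (Ne.symm hw)
    cases h1 : A' v w <;> cases h2 : B' v w <;> simp_all [c]
  have h3 : ∀ v j, colorDegree c v (.inr j) = 0 := fun v j => by
    rw [colorDegree, card_eq_zero, filter_eq_empty_iff]
    rintro w - ⟨_, h⟩
    cases h1 : A' v w <;> cases h2 : B' v w <;> simp [c, h1, h2] at h
  refine ⟨c, fun x y => by simp only [c, hA' x y, hB' x y], h0, h1, fun v => ?_, h3⟩
  have hsum := sum_colorDegree c v univ
  have hcard : #{w | w ≠ v ∧ c v w ∈ (univ : Finset (Fin 3 ⊕ Fin 4))} = Fintype.card V - 1 := by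
    rw [← card_univ, ← card_erase_of_mem (mem_univ v)]
    congr 1
    ext w
    simp
  rw [hcard, Fintype.sum_sum_type, Fin.sum_univ_three, sum_eq_zero fun j _ => h3 v j, h0, h1]
    at hsum
  have := hdeg v
  omega

/-- Perfect matchings can be extracted from the color `inl 2` one after the other. -/
lemma exists_extracted_coloring (hV : Even (Fintype.card V)) {k : ℕ} {α β : V → ℕ}
    (hαβ : ∀ v w, α v + β v = α w + β w) {c : V → V → Fin 3 ⊕ Fin 4}
    (hc : ∀ x y, c x y = c y x) (h0 : ∀ v, colorDegree c v (.inl 0) = α v)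
    (h1 : ∀ v, colorDegree c v (.inl 1) = β v) (h2 : ∀ v, colorDegree c v (.inl 2) = k)
    (h3 : ∀ v j, colorDegree c v (.inr j) = 0) {r : ℕ} (hr : r ≤ 4) (hrk : r ≤ k) :
    ∃ c' : V → V → Fin 3 ⊕ Fin 4, (∀ x y, c' x y = c' y x) ∧
      (∀ v, colorDegree c' v (.inl 0) = α v) ∧ (∀ v, colorDegree c' v (.inl 1) = β v) ∧
      (∀ v, colorDegree c' v (.inl 2) = k - r) ∧
      ∀ v (j : Fin 4), colorDegree c' v (.inr j) = if (j : ℕ) < r then 1 else 0 := by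
  induction r with
  | zero => exact ⟨c, hc, h0, h1, h2, by simpa using h3⟩
  | succ r ih =>
    obtain ⟨c₁, g, g0, g1, g2, g3⟩ := ih (by omega) (by omega)
    set j₀ : Fin 4 := ⟨r, by omega⟩
    have hz : ∀ z : Fin 3 ⊕ Fin 4, z ≠ .inl 0 → z ≠ .inl 1 → z ≠ .inl 2 → ∃ j, z = .inr j := by
      decide
    obtain ⟨c', e, e2, em, eo⟩ := exists_extraction (a := .inl 0) (b := .inl 1) (f := .inl 2)
      (m := .inr j₀) (K := k - (r + 1)) g hV (by simp) (fun v => by rw [g2]; omega)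
      (fun v => by rw [g3]; simp [j₀]) (by decide) (by decide) (by decide) (by simp) (by simp)
      (by simp) (fun v w => by rw [g0, g1, g0, g1, hαβ v w])
      (fun z z0 z1 z2 _ v w => by
        obtain ⟨j, rfl⟩ := hz z z0 z1 z2
        rw [g3, g3])
      (fun z z0 z1 z2 _ v => by
        obtain ⟨j, rfl⟩ := hz z z0 z1 z2
        rw [g3]; split_ifs <;> simp)
    refine ⟨c', e, fun v => ?_, fun v => ?_, e2, fun v j => ?_⟩
    · rw [eo _ (by decide) (by simp), g0]
    · rw [eo _ (by decide) (by simp), g1]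
    · by_cases hj : j = j₀
      · rw [hj, em]; simp [j₀]
      · have hjr : (j : ℕ) ≠ r := fun h => hj (Fin.ext h)
        rw [eo _ (by simp) (by simpa using hj), g3]
        congr 1
        simp only [eq_iff_iff]
        omega

end Assembly

end EdgeColoring

open EdgeColoring in
theorem theorem3 (n k : ℕ) (hn : Even n) (hk : 4 ≤ k) (π : Fin n → ℤ)
    (hπ : DegreeSequence.Graphic π)
    (hπk : DegreeSequence.Graphic (fun i => π i - (k : ℤ))) :
    ∃ G : SimpleGraph (Fin n), DegreeSequence.Realizes G π ∧
      ∃ (F : SimpleGraph (Fin n)) (M : Fin 4 → SimpleGraph (Fin n)),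
        DegreeSequence.IsFactor F G (k - 4) ∧
        (∀ j, DegreeSequence.IsFactor (M j) G 1) ∧
        (∀ j, Disjoint F.edgeSet (M j).edgeSet) ∧
        (∀ i j, i ≠ j → Disjoint (M i).edgeSet (M j).edgeSet) := by
  classical
  obtain ⟨G, hG⟩ := hπ
  obtain ⟨H, hH⟩ := hπk
  have hGd : ∀ v, (G.degree v : ℤ) = π v := fun v => by convert hG v
  have hHd : ∀ v, (H.degree v : ℤ) = π v - k := fun v => by convert hH v
  have hdeg : ∀ v, H.degree v + Gᶜ.degree v + k + 1 = n := by
    intro v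
    have h1 := hGd v
    have h2 := hHd v
    have h3 := G.degree_compl (v := v)
    have h4 := G.degree_lt_card_verts v
    rw [Fintype.card_fin] at h3 h4
    omega
  obtain ⟨c₀, hc₀, e0, e1, e2, e3⟩ := exists_initial_coloring
    (A := fun x y => decide (H.Adj x y)) (B := fun x y => decide (Gᶜ.Adj x y)) (k := k)
    (fun x y => by simp only [H.adj_comm]) (fun x y => by simp only [Gᶜ.adj_comm])
    (fun v => by rw [colorDegree_decide_adj, colorDegree_decide_adj, Fintype.card_fin, hdeg])
  simp only [colorDegree_decide_adj] at e0 e1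
  obtain ⟨c, hc, -, h1, h2, h3⟩ := exists_extracted_coloring (by simpa using hn)
    (fun v w => by have := hdeg v; have := hdeg w; omega) hc₀ e0 e1 e2 e3 le_rfl hk
  have hle : ∀ z, z ≠ .inl 1 → colorClass c hc z ≤ (colorClass c hc (.inl 1))ᶜ := by
    intro z hz x y hxy
    rw [SimpleGraph.compl_adj]
    exact ⟨hxy.1, fun h => hz (hxy.2.symm.trans h.2)⟩
  have hdisj : ∀ z z', z ≠ z' →
      Disjoint (colorClass c hc z).edgeSet (colorClass c hc z').edgeSet := by
    intro z z' hz
    rw [Set.disjoint_left]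
    intro e
    induction e with
    | _ x y => exact fun h h' => hz (h.2.symm.trans h'.2)
  refine ⟨(colorClass c hc (.inl 1))ᶜ, fun v => ?_, colorClass c hc (.inl 2),
    fun j => colorClass c hc (.inr j), ⟨hle _ (by decide), fun v => ?_⟩,
    fun j => ⟨hle _ (by simp), fun v => ?_⟩, fun j => hdisj _ _ (by simp),
    fun i j hij => hdisj _ _ (by simpa using hij)⟩
  · have g1 := (colorClass c hc (.inl 1)).degree_compl (v := v)
    have g2 := G.degree_compl (v := v)
    have g3 := G.degree_lt_card_verts v
    have g4 := hGd v
    rw [degree_colorClass, h1, Fintype.card_fin] at g1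
    rw [Fintype.card_fin] at g2 g3
    have g5 : (colorClass c hc (.inl 1))ᶜ.degree v = G.degree v := by omega
    rw [← g4, ← g5]
    congr!
  · rw [← h2 v]
    exact degree_colorClass c hc _ v
  · have := h3 v j
    rw [if_pos j.2] at this
    rw [← this]
    exact degree_colorClass c hc _ v
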